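/- Let $M\subset\mathbb R^s$ be a compact $m$-dimensional $C^\infty$ embedded submanifold without boundary. Let $C$ be its cutlocus: the set of $x\in\mathbb R^s$ for which either the nearest point $\pi(x)$ of $M$ is not uniquely defined, or the function $L_x(q)=\|q-x\|^2$ on $M$ has a degenerate second derivative at $q=\pi(x)$. Put $d(t,C)=\inf_{c\in C}\|t-c\|$ (with $d(t,\emptyset)=\infty$). For $\mu\in M$ let $\tan_\mu$ and $\operatorname{nor}_\mu=I_s-\tan_\mu$ be the matrices of the orthogonal projections of $\mathbb R^s$ onto the tangent space $T_\mu M$ and its orthogonal complement. Matrix norms are operator norms, $V^{1/2}$ is the positive definite square root of a positive definite $V$, and $\le$ between symmetric matrices is the Loewner order. Let $t_n\in\mathbb R^s\setminus C$ be a sequence, $\mu_n=\pi(t_n)$, and let $a_n$ be real numbers with $a_n\to\infty$. For invertible matrices $B_n$ and matrices $\Gamma_n$ consider the conditions $$\text{(2.2)}\quad B_n/d(t_n,C)\to0,\qquad\qquad \text{(2.6)}\quad \|\Gamma_n\|\,\|B_n\|^2/d(t_n,C)^2\to0,$$ $$\text{(2.7)}\quad \Gamma_n\tan_{\mu_n}B_nB_n^T\tan_{\mu_n}\Gamma_n^T=\tan_{\mu_n}.$$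 **Corollary 2.1.** Let $V$ be a positive definite $s\times s$ matrix and $B_n=a_n^{-1}V^{1/2}$. 1. Condition (2.2) holds if and only if $a_n\,d(t_n,C)\to\infty$. 2. The matrix $\operatorname{nor}_{\mu_n}+\tan_{\mu_n}V\tan_{\mu_n}$ is positive definite, and $\Gamma_n=a_n(\operatorname{nor}_{\mu_n}+\tan_{\mu_n}V\tan_{\mu_n})^{-1/2}$ satisfies (2.7) for every $n$ with $a_n\ne0$. With this choice of $\Gamma_n$, condition (2.6) holds if and only if $a_n\,d(t_n,C)^2\to\infty$. More generally, both statements remain true with $V$ replaced by $V_n$ throughout, that is, for $B_n=a_n^{-1}V_n^{1/2}$ and $\Gamma_n=a_n(\operatorname{nor}_{\mu_n}+\tan_{\mu_n}V_n\tan_{\mu_n})^{-1/2}$, whenever $V_n$, $V^*$, $V^{**}$ are positive definite matrices with $V^*\le V_n\le V^{**}$ for all $n$. -/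

import Mathlib

open Filter Topology Metric
open scoped ContDiff ENNReal MatrixOrder Matrix.Norms.L2Operator

noncomputable section

namespace MeanLocation

/-- Euclidean space `ℝ^k` with the Euclidean norm. -/
abbrev Euc (k : ℕ) : Type := EuclideanSpace ℝ (Fin k)

/-- `φ : W → M`, with `W ⊆ ℝ^m` an open neighbourhood of `0`, is a smooth local parametrization of
`M ⊆ ℝ^s` centred at `p`: a `C^∞` immersion, homeomorphic onto a relatively open piece of `M`,
with `φ 0 = p`. -/
structure IsLocalParametrization {s : ℕ} (m : ℕ) (M : Set (Euc s)) (p : Euc s)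
    (W : Set (Euc m)) (φ : Euc m → Euc s) : Prop where
  isOpen : IsOpen W
  zero_mem : (0 : Euc m) ∈ W
  map_zero : φ 0 = p
  contDiffOn : ContDiffOn ℝ ∞ φ W
  immersion : ∀ x ∈ W, Function.Injective (fderiv ℝ φ x)
  embedding : IsEmbedding (W.domRestrict φ)
  image_eq : ∃ U : Set (Euc s), IsOpen U ∧ φ '' W = M ∩ U

/-- `M` is an `m`-dimensional smooth embedded submanifold (without boundary) of `ℝ^s`. -/
def IsSubmanifold {s : ℕ} (m : ℕ) (M : Set (Euc s)) : Prop :=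
  ∀ p ∈ M, ∃ W φ, IsLocalParametrization m M p W φ

/-- The tangent space `T_μ M`: the velocities at `μ` of smooth curves in `M` through `μ`
(for a submanifold they already form a linear subspace, so that the span adds nothing). -/
def tangentSpace {s : ℕ} (M : Set (Euc s)) (μ : Euc s) : Submodule ℝ (Euc s) :=
  Submodule.span ℝ {v | ∃ γ : ℝ → Euc s, ContDiffAt ℝ ∞ γ 0 ∧ (∀ᶠ u in 𝓝 0, γ u ∈ M) ∧
    γ 0 = μ ∧ HasDerivAt γ v 0}

/-- The matrix `tan_μ` of the orthogonal projection of `ℝ^s` onto `T_μ M`. -/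
def tanMatrix {s : ℕ} (M : Set (Euc s)) (μ : Euc s) : Matrix (Fin s) (Fin s) ℝ :=
  (Matrix.toEuclideanCLM (n := Fin s) (𝕜 := ℝ)).symm (tangentSpace M μ).starProjection

/-- The matrix `nor_μ = I - tan_μ` of the orthogonal projection onto the normal space. -/
def norMatrix {s : ℕ} (M : Set (Euc s)) (μ : Euc s) : Matrix (Fin s) (Fin s) ℝ :=
  1 - tanMatrix M μ

/-- `p` is a point of `M` nearest to `x`. -/
def IsNearest {s : ℕ} (M : Set (Euc s)) (x p : Euc s) : Prop :=
  p ∈ M ∧ ∀ q ∈ M, ‖p - x‖ ^ 2 ≤ ‖q - x‖ ^ 2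

/-- The nearest-point mapping `π` (meaningful where the nearest point exists and is unique). -/
def nearestPoint {s : ℕ} (M : Set (Euc s)) (x : Euc s) : Euc s :=
  Classical.epsilon (IsNearest M x)

/-- The square distance function `L_x(q) = ‖q - x‖²` on the `m`-dimensional submanifold `M` has a
degenerate second derivative at `p`: in a local parametrization centred at `p`, its second
derivative is a degenerate bilinear form. (At a critical point `p` of `L_x`, such as a nearest
point, this does not depend on the parametrization.) -/
def HasDegenerateHessian {s : ℕ} (m : ℕ) (M : Set (Euc s)) (x p : Euc s) : Prop :=
  ∃ W φ, IsLocalParametrization m M p W φ ∧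
    ∃ v : Euc m, v ≠ 0 ∧
      ∀ w : Euc m, fderiv ℝ (fderiv ℝ (fun y => ‖φ y - x‖ ^ 2)) 0 v w = 0

/-- The cutlocus of the `m`-dimensional submanifold `M`: the points without a unique nearest point
in `M`, or for which `L_x` has a degenerate second derivative at the nearest point. -/
def cutlocus {s : ℕ} (m : ℕ) (M : Set (Euc s)) : Set (Euc s) :=
  {x | (¬ ∃! p, IsNearest M x p) ∨ ∃ p, IsNearest M x p ∧ HasDegenerateHessian m M x p}

/-- `B_n / d(t_n, C) → 0` in operator norm. The distance `d(t, C) = infEDist t C` takes its values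
in `[0, ∞]`, and is `∞` exactly if `C` is empty. -/
def ScaleCondition {s : ℕ} (C : Set (Euc s)) (t : ℕ → Euc s)
    (B : ℕ → Matrix (Fin s) (Fin s) ℝ) : Prop :=
  Tendsto (fun n => ENNReal.ofReal ‖B n‖ / infEDist (t n) C) atTop (𝓝 0)

/-- `‖Γ_n‖ ‖B_n‖² / d(t_n, C)² → 0`, with operator norms. -/
def StabilizedScaleCondition {s : ℕ} (C : Set (Euc s)) (t : ℕ → Euc s)
    (B Γ : ℕ → Matrix (Fin s) (Fin s) ℝ) : Prop :=
  Tendsto (fun n => ENNReal.ofReal (‖Γ n‖ * ‖B n‖ ^ 2) / infEDist (t n) C ^ 2) atTop (𝓝 0)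

/-- `B = a⁻¹ V^{1/2}`. -/
def scaleMatrix {s : ℕ} (a : ℝ) (V : Matrix (Fin s) (Fin s) ℝ) : Matrix (Fin s) (Fin s) ℝ :=
  a⁻¹ • CFC.sqrt V

/-- `nor_μ + tan_μ V tan_μ`. -/
def stabilizedMatrix {s : ℕ} (M : Set (Euc s)) (μ : Euc s) (V : Matrix (Fin s) (Fin s) ℝ) :
    Matrix (Fin s) (Fin s) ℝ :=
  norMatrix M μ + tanMatrix M μ * V * tanMatrix M μ

/-- `Γ = a (nor_μ + tan_μ V tan_μ)^{-1/2}`. -/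
def gammaMatrix {s : ℕ} (M : Set (Euc s)) (μ : Euc s) (a : ℝ) (V : Matrix (Fin s) (Fin s) ℝ) :
    Matrix (Fin s) (Fin s) ℝ :=
  a • (CFC.sqrt (stabilizedMatrix M μ V))⁻¹

/-- The normalization `Γ tan_μ B Bᵀ tan_μ Γᵀ = tan_μ`. -/
def IsNormalizing {s : ℕ} (M : Set (Euc s)) (μ : Euc s)
    (B Γ : Matrix (Fin s) (Fin s) ℝ) : Prop :=
  Γ * tanMatrix M μ * B * B.transpose * tanMatrix M μ * Γ.transpose = tanMatrix M μ

end MeanLocation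

end

open Filter Topology Metric
open scoped ContDiff ENNReal MatrixOrder Matrix.Norms.L2Operator

/-! ### Operator norms and the Loewner order for real matrices -/

namespace Matrix

variable {n : Type*} [DecidableEq n]

/-! Write S = nor + tan V tan. Everything reduces to two-sided bounds, uniform in n, showing that
‖B‖ and ‖Γ‖‖B‖² are both of exact order a⁻¹. Then `tendsto_ofReal_div_nhds_zero_iff` trades each
quotient tending to 0 for a product tending to ∞. Here ‖B‖ = a⁻¹‖V‖^{1/2} and ‖Γ‖‖B‖² =
a⁻¹‖S^{-1/2}‖‖V‖. Monotonicity of the norm in the Loewner order controls ‖V‖, and S ≥ min(1, c)·1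
together with ‖S‖ ≤ 2 + ‖V‖ controls ‖S^{-1/2}‖. The normalization is algebra: S fixes nor, so
S^{1/2} does too, and tan V tan = S - nor. -/

lemma posDef_of_smul_one_le {A : Matrix n n ℝ} {c : ℝ} (hc : 0 < c)
    (h : c • (1 : Matrix n n ℝ) ≤ A) : A.PosDef := by
  have := (PosDef.one (n := n) (R := ℝ)).smul hc |>.add_posSemidef (le_iff.1 h)
  rwa [add_sub_cancel] at this

variable [Fintype n]

lemma star_sqrt (A : Matrix n n ℝ) : star (CFC.sqrt A) = CFC.sqrt A :=
  (nonneg_iff_posSemidef.1 (CFC.sqrt_nonneg A)).isHermitian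

lemma norm_sqrt_sq {A : Matrix n n ℝ} (hA : 0 ≤ A) : ‖CFC.sqrt A‖ ^ 2 = ‖A‖ := by
  have hR := star_sqrt A
  have h := CStarRing.norm_star_mul_self (x := CFC.sqrt A)
  rw [hR, CFC.sqrt_mul_sqrt_self A hA] at h
  rw [h, sq]

/-- ‖A^{1/2}x‖² = ⟨x, Ax⟩ ≤ ⟨x, Bx⟩ ≤ ‖B‖‖x‖², and ‖A‖ = ‖A^{1/2}‖². -/
lemma norm_le_norm_of_nonneg_of_le {A B : Matrix n n ℝ} (hA : 0 ≤ A) (hAB : A ≤ B) :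
    ‖A‖ ≤ ‖B‖ := by
  have hR := star_sqrt A
  have key : ‖CFC.sqrt A‖ ≤ √‖B‖ := by
    rw [cstar_norm_def]
    refine ContinuousLinearMap.opNorm_le_bound _ (Real.sqrt_nonneg _) fun x => ?_
    refine (sq_le_sq₀ (norm_nonneg _) (by positivity)).1 ?_
    have h1 : ‖toEuclideanCLM (n := n) (𝕜 := ℝ) (CFC.sqrt A) x‖ ^ 2 =
        inner ℝ x (toEuclideanCLM (n := n) (𝕜 := ℝ) A x) := by
      rw [← real_inner_self_eq_norm_sq, ← ContinuousLinearMap.adjoint_inner_right,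
        ← ContinuousLinearMap.star_eq_adjoint, ← map_star, hR, ← mul_apply_eq_comp,
        ← map_mul, CFC.sqrt_mul_sqrt_self A hA]
    have h2 : inner ℝ x (toEuclideanCLM (n := n) (𝕜 := ℝ) A x) ≤
        inner ℝ x (toEuclideanCLM (n := n) (𝕜 := ℝ) B x) := by
      rw [← sub_nonneg, ← inner_sub_right, ← _root_.sub_apply, ← map_sub,
        inner_toEuclideanCLM]
      simpa using (le_iff.1 hAB).dotProduct_mulVec_nonneg x.ofLp
    have h3 : inner ℝ x (toEuclideanCLM (n := n) (𝕜 := ℝ) B x) ≤ ‖x‖ * (‖B‖ * ‖x‖) :=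
      (real_inner_le_norm _ _).trans
        (mul_le_mul_of_nonneg_left (ContinuousLinearMap.le_opNorm _ _) (norm_nonneg _))
    rw [h1, mul_pow, Real.sq_sqrt (norm_nonneg _)]
    linarith
  rw [← norm_sqrt_sq hA]
  exact (Real.le_sqrt (norm_nonneg _) (norm_nonneg _)).1 key

lemma star_sqrt_inv (A : Matrix n n ℝ) : star (CFC.sqrt A)⁻¹ = (CFC.sqrt A)⁻¹ :=
  IsHermitian.inv (star_sqrt A)

lemma PosDef.isUnit_det_sqrt {A : Matrix n n ℝ} (hA : A.PosDef) : IsUnit (CFC.sqrt A).det :=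
  (isUnit_iff_isUnit_det _).1 ((CFC.isUnit_sqrt_iff A hA.posSemidef.nonneg).2 hA.isUnit)

/-- The spectrum is compact and positive, hence bounded away from 0. -/
lemma PosDef.exists_pos_smul_one_le {A : Matrix n n ℝ} (hA : A.PosDef) :
    ∃ c : ℝ, 0 < c ∧ c • (1 : Matrix n n ℝ) ≤ A := by
  rcases isEmpty_or_nonempty n with h | h
  · exact ⟨1, one_pos, (Subsingleton.elim _ _).le⟩
  obtain ⟨c, hc, hcA⟩ := (CFC.exists_pos_algebraMap_le_iff (a := A) hA.isHermitian).2
    fun x hx => hA.isStrictlyPositive.spectrum_pos hx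
  exact ⟨c, hc, by rwa [Algebra.algebraMap_eq_smul_one] at hcA⟩

/-- Conjugating c·1 ≤ A by A^{-1/2} gives c·A⁻¹ ≤ 1; then take norms and use the C*-identity. -/
lemma norm_sqrt_inv_sq_le {A : Matrix n n ℝ} {c : ℝ} (hc : 0 < c)
    (h : c • (1 : Matrix n n ℝ) ≤ A) : ‖(CFC.sqrt A)⁻¹‖ ^ 2 ≤ c⁻¹ := by
  have hA := posDef_of_smul_one_le hc h
  have hR := star_sqrt_inv A
  have hu := hA.isUnit_det_sqrt
  set R := CFC.sqrt A with hRdef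
  have hRR : R * R = A := CFC.sqrt_mul_sqrt_self A hA.posSemidef.nonneg
  have h1 : c • (R⁻¹ * R⁻¹) ≤ 1 := by
    have := star_left_conjugate_le_conjugate h R⁻¹
    rw [hR, ← hRR, ← mul_assoc, nonsing_inv_mul _ hu, one_mul, mul_nonsing_inv _ hu] at this
    simpa using this
  have h0 : 0 ≤ c • (R⁻¹ * R⁻¹) := by
    have h2 : 0 ≤ star R⁻¹ * R⁻¹ := star_mul_self_nonneg _
    rw [hR] at h2
    exact ((nonneg_iff_posSemidef.1 h2).smul hc.le).nonneg
  have h3 := norm_le_norm_of_nonneg_of_le h0 h1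
  have h4 := CStarRing.norm_star_mul_self (x := R⁻¹)
  -- Only an inequality: for an empty index type this norm is 0.
  have h5 : ‖(1 : Matrix n n ℝ)‖ ≤ 1 := by
    rw [cstar_norm_def, map_one]
    exact ContinuousLinearMap.norm_id_le
  rw [hR] at h4
  rw [norm_smul, h4, Real.norm_of_nonneg hc.le] at h3
  rw [← one_div (c : ℝ), le_div_iff₀ hc]
  nlinarith

lemma PosDef.one_le_norm_sqrt_inv_mul [Nonempty n] {A : Matrix n n ℝ} (hA : A.PosDef) :
    1 ≤ ‖(CFC.sqrt A)⁻¹‖ * ‖CFC.sqrt A‖ := by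
  have h := norm_mul_le (CFC.sqrt A)⁻¹ (CFC.sqrt A)
  rwa [nonsing_inv_mul _ hA.isUnit_det_sqrt, CStarRing.norm_one] at h

/-- If `N` is fixed by multiplication with `S` on either side, then
`S^{-1/2} (S - N) S^{-1/2} = 1 - N`. -/
lemma PosDef.sqrt_inv_mul_sub_mul_sqrt_inv {S N : Matrix n n ℝ} (hS : S.PosDef)
    (hl : N * S = N) (hr : S * N = N) :
    (CFC.sqrt S)⁻¹ * (S - N) * (CFC.sqrt S)⁻¹ = 1 - N := by
  have hu := hS.isUnit_det_sqrt
  have hRR : CFC.sqrt S * CFC.sqrt S = S := CFC.sqrt_mul_sqrt_self S hS.posSemidef.nonneg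
  -- Functional calculus carries commutation from S to its square root R, so that R N R = R² N = N.
  have hcomm : Commute (CFC.sqrt S) N := by
    have : Commute S N := by rw [commute_iff_eq, hl, hr]
    rw [CFC.sqrt_eq_cfc]
    exact this.cfc_nnreal _
  have hcomm' := hcomm.eq
  set R := CFC.sqrt S
  have hN : R⁻¹ * N * R⁻¹ = N := by
    have h1 : N = R * N * R := by rw [mul_assoc, ← hcomm', ← mul_assoc, hRR, hr]
    conv_lhs => rw [h1]
    rw [← mul_assoc, ← mul_assoc, nonsing_inv_mul _ hu, one_mul, mul_assoc, mul_nonsing_inv _ hu,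
      mul_one]
  rw [mul_sub, sub_mul, hN, ← hRR, ← mul_assoc, nonsing_inv_mul _ hu, one_mul,
    mul_nonsing_inv _ hu]

end Matrix

/-! ### Comparison of extended-real asymptotics -/

lemma tendsto_ofReal_div_nhds_zero_iff {ι : Type*} {l : Filter ι} {a u : ι → ℝ} {e : ι → ℝ≥0∞}
    {c₁ c₂ : ℝ} (hc₁ : 0 < c₁) (ha : ∀ᶠ i in l, 0 < a i)
    (hl : ∀ᶠ i in l, c₁ * (a i)⁻¹ ≤ u i) (hu : ∀ᶠ i in l, u i ≤ c₂ * (a i)⁻¹) :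
    Tendsto (fun i => ENNReal.ofReal (u i) / e i) l (𝓝 0) ↔
      Tendsto (fun i => ENNReal.ofReal (a i) * e i) l (𝓝 ⊤) := by
  have hinv : ∀ᶠ i in l,
      (ENNReal.ofReal (a i) * e i)⁻¹ = ENNReal.ofReal (a i)⁻¹ * (e i)⁻¹ := by
    filter_upwards [ha] with i hi
    -- Inversion could fail to be multiplicative only at 0·∞, but `ENNReal.ofReal (a i)` is neither
    -- 0 nor ∞.
    rw [ENNReal.mul_inv (.inl (by simpa using hi)) (.inl ENNReal.ofReal_ne_top),
      ENNReal.ofReal_inv_of_pos hi]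
  rw [← tendsto_inv_iff (m := fun i => ENNReal.ofReal (a i) * e i), ENNReal.inv_top,
    tendsto_congr' hinv]
  simp only [div_eq_mul_inv]
  constructor <;> intro h
  · have h' := ENNReal.Tendsto.const_mul (a := ENNReal.ofReal c₁⁻¹) h
      (.inr ENNReal.ofReal_ne_top)
    rw [mul_zero] at h'
    refine tendsto_of_tendsto_of_tendsto_of_le_of_le' tendsto_const_nhds h'
      (.of_forall fun _ => zero_le) ?_
    filter_upwards [hl] with i hi
    rw [← mul_assoc, ← ENNReal.ofReal_mul (by positivity)]
    gcongr
    rwa [← div_eq_inv_mul, le_div_iff₀ hc₁, mul_comm]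
  · have h' := ENNReal.Tendsto.const_mul (a := ENNReal.ofReal c₂) h (.inr ENNReal.ofReal_ne_top)
    rw [mul_zero] at h'
    refine tendsto_of_tendsto_of_tendsto_of_le_of_le' tendsto_const_nhds h'
      (.of_forall fun _ => zero_le) ?_
    filter_upwards [hu, ha] with i hi hai
    rw [← mul_assoc, ← ENNReal.ofReal_mul' (by positivity)]
    gcongr

namespace MeanLocation

variable {s : ℕ}

/-! ### The tangential and normal projections -/

lemma tanMatrix_mul_self (M : Set (Euc s)) (μ : Euc s) :
    tanMatrix M μ * tanMatrix M μ = tanMatrix M μ := by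
  rw [tanMatrix, ← map_mul]
  exact congrArg _ (tangentSpace M μ).isIdempotentElem_starProjection

lemma star_tanMatrix (M : Set (Euc s)) (μ : Euc s) : star (tanMatrix M μ) = tanMatrix M μ := by
  refine (map_star (Matrix.toEuclideanCLM (n := Fin s) (𝕜 := ℝ)).symm _).symm.trans ?_
  exact congrArg _ (isSelfAdjoint_starProjection (tangentSpace M μ)).star_eq

lemma norm_tanMatrix_le (M : Set (Euc s)) (μ : Euc s) : ‖tanMatrix M μ‖ ≤ 1 := by
  rw [Matrix.cstar_norm_def, tanMatrix, StarAlgEquiv.apply_symm_apply]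
  exact Submodule.starProjection_norm_le _

lemma norMatrix_mul_tanMatrix (M : Set (Euc s)) (μ : Euc s) :
    norMatrix M μ * tanMatrix M μ = 0 := by
  rw [norMatrix, sub_mul, one_mul, tanMatrix_mul_self, sub_self]

lemma tanMatrix_mul_norMatrix (M : Set (Euc s)) (μ : Euc s) :
    tanMatrix M μ * norMatrix M μ = 0 := by
  rw [norMatrix, mul_sub, mul_one, tanMatrix_mul_self, sub_self]

lemma norMatrix_mul_self (M : Set (Euc s)) (μ : Euc s) :
    norMatrix M μ * norMatrix M μ = norMatrix M μ := by
  conv_lhs => enter [2]; rw [norMatrix]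
  rw [mul_sub, mul_one, norMatrix_mul_tanMatrix, sub_zero]

lemma norMatrix_nonneg (M : Set (Euc s)) (μ : Euc s) : 0 ≤ norMatrix M μ := by
  have h : star (norMatrix M μ) = norMatrix M μ := by
    rw [norMatrix, star_sub, star_one, star_tanMatrix]
  have h' := star_mul_self_nonneg (norMatrix M μ)
  rwa [h, norMatrix_mul_self] at h'

/-! ### The stabilized matrix -/

lemma norMatrix_mul_stabilizedMatrix (M : Set (Euc s)) (μ : Euc s)
    (V : Matrix (Fin s) (Fin s) ℝ) :
    norMatrix M μ * stabilizedMatrix M μ V = norMatrix M μ := by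
  rw [stabilizedMatrix, mul_add, ← mul_assoc, ← mul_assoc, norMatrix_mul_tanMatrix, zero_mul,
    zero_mul, add_zero, norMatrix_mul_self]

lemma stabilizedMatrix_mul_norMatrix (M : Set (Euc s)) (μ : Euc s)
    (V : Matrix (Fin s) (Fin s) ℝ) :
    stabilizedMatrix M μ V * norMatrix M μ = norMatrix M μ := by
  rw [stabilizedMatrix, add_mul, mul_assoc _ _ (norMatrix M μ), tanMatrix_mul_norMatrix, mul_zero,
    add_zero, norMatrix_mul_self]

/-- With d = min(1, c): nor ≥ d·nor since d ≤ 1, tan V tan ≥ d·tan since V ≥ d·1, and nor + tan = 1.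
-/
lemma min_smul_one_le_stabilizedMatrix (M : Set (Euc s)) (μ : Euc s)
    {V : Matrix (Fin s) (Fin s) ℝ} {c : ℝ} (h : c • (1 : Matrix (Fin s) (Fin s) ℝ) ≤ V) :
    min 1 c • (1 : Matrix (Fin s) (Fin s) ℝ) ≤ stabilizedMatrix M μ V := by
  set d := min 1 c
  have h1 : d • (1 : Matrix (Fin s) (Fin s) ℝ) ≤ V := by
    refine le_trans ?_ h
    rw [Matrix.le_iff, ← sub_smul]
    exact Matrix.PosSemidef.one.smul (sub_nonneg.2 (min_le_right 1 c))
  have h2 := star_left_conjugate_le_conjugate h1 (tanMatrix M μ)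
  have h3 : d • norMatrix M μ ≤ norMatrix M μ := by
    have := (Matrix.nonneg_iff_posSemidef.1 (norMatrix_nonneg M μ)).smul (sub_nonneg.2 (min_le_left 1 c))
    rwa [sub_smul, one_smul] at this
  rw [star_tanMatrix, mul_smul_comm, smul_mul_assoc, mul_one, tanMatrix_mul_self] at h2
  have h4 := add_le_add h3 h2
  rwa [← smul_add, norMatrix, sub_add_cancel] at h4

lemma posDef_stabilizedMatrix (M : Set (Euc s)) (μ : Euc s) {V : Matrix (Fin s) (Fin s) ℝ}
    (hV : V.PosDef) : (stabilizedMatrix M μ V).PosDef := by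
  obtain ⟨c, hc, h⟩ := hV.exists_pos_smul_one_le
  exact Matrix.posDef_of_smul_one_le (lt_min one_pos hc) (min_smul_one_le_stabilizedMatrix M μ h)

lemma norm_stabilizedMatrix_le [NeZero s] (M : Set (Euc s)) (μ : Euc s)
    (V : Matrix (Fin s) (Fin s) ℝ) : ‖stabilizedMatrix M μ V‖ ≤ 2 + ‖V‖ := by
  have hT := norm_tanMatrix_le M μ
  have h1 : ‖norMatrix M μ‖ ≤ 2 := by
    refine (norm_sub_le _ _).trans ?_
    rw [CStarRing.norm_one]
    linarith
  have h2 : ‖tanMatrix M μ * V * tanMatrix M μ‖ ≤ ‖V‖ := calc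
    _ ≤ ‖tanMatrix M μ‖ * ‖V‖ * ‖tanMatrix M μ‖ :=
      (norm_mul_le _ _).trans (by gcongr; exact norm_mul_le _ _)
    _ ≤ 1 * ‖V‖ * 1 := by gcongr
    _ = ‖V‖ := by ring
  exact (norm_add_le _ _).trans (add_le_add h1 h2)

lemma isNormalizing_gammaMatrix (M : Set (Euc s)) (μ : Euc s) {V : Matrix (Fin s) (Fin s) ℝ}
    (hV : V.PosDef) {a : ℝ} (ha : a ≠ 0) :
    IsNormalizing M μ (scaleMatrix a V) (gammaMatrix M μ a V) := by
  have hS := posDef_stabilizedMatrix M μ hV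
  have hsq : CFC.sqrt V * CFC.sqrt V = V := CFC.sqrt_mul_sqrt_self V hV.posSemidef.nonneg
  have hVt : (CFC.sqrt V).transpose = CFC.sqrt V := by
    simpa [Matrix.star_eq_conjTranspose, Matrix.conjTranspose_eq_transpose_of_trivial] using
      Matrix.star_sqrt V
  have hSt : ((CFC.sqrt (stabilizedMatrix M μ V))⁻¹).transpose =
      (CFC.sqrt (stabilizedMatrix M μ V))⁻¹ := by
    simpa [Matrix.star_eq_conjTranspose, Matrix.conjTranspose_eq_transpose_of_trivial] using
      Matrix.star_sqrt_inv (stabilizedMatrix M μ V)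
  have h := hS.sqrt_inv_mul_sub_mul_sqrt_inv (norMatrix_mul_stabilizedMatrix M μ V)
    (stabilizedMatrix_mul_norMatrix M μ V)
  have hsub : stabilizedMatrix M μ V - norMatrix M μ = tanMatrix M μ * V * tanMatrix M μ := by
    rw [stabilizedMatrix, add_sub_cancel_left]
  rw [hsub, norMatrix, sub_sub_cancel] at h
  rw [IsNormalizing, gammaMatrix, scaleMatrix, Matrix.transpose_smul, Matrix.transpose_smul, hVt,
    hSt]
  simp only [smul_mul_assoc, mul_smul_comm, smul_smul]
  rw [show a * (a⁻¹ * (a⁻¹ * a)) = 1 by field_simp, one_smul]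
  conv_rhs => rw [← h]; enter [1, 2, 1, 2]; rw [← hsq]
  simp only [mul_assoc]

lemma norm_scaleMatrix {a : ℝ} (ha : 0 < a) (V : Matrix (Fin s) (Fin s) ℝ) :
    ‖scaleMatrix a V‖ = ‖CFC.sqrt V‖ * a⁻¹ := by
  rw [scaleMatrix, norm_smul, Real.norm_of_nonneg (inv_nonneg.2 ha.le), mul_comm]

lemma norm_gammaMatrix_mul_norm_scaleMatrix_sq (M : Set (Euc s)) (μ : Euc s) {a : ℝ} (ha : 0 < a)
    {V : Matrix (Fin s) (Fin s) ℝ} (hV : 0 ≤ V) :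
    ‖gammaMatrix M μ a V‖ * ‖scaleMatrix a V‖ ^ 2 =
      ‖(CFC.sqrt (stabilizedMatrix M μ V))⁻¹‖ * ‖V‖ * a⁻¹ := by
  rw [norm_scaleMatrix ha, mul_pow, Matrix.norm_sqrt_sq hV, gammaMatrix, norm_smul,
    Real.norm_of_nonneg ha.le]
  field_simp

/-! ### The scale conditions -/

/-- In dimension 0 all matrix norms vanish and the lower bounds break down. But then the distance is
∞, and both sides of each equivalence hold. -/
lemma cutlocus_eq_empty_of_dim_zero {m : ℕ} {M : Set (Euc 0)} {t : Euc 0}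
    (ht : t ∉ cutlocus m M) : cutlocus m M = ∅ := by
  refine Set.eq_empty_of_forall_notMem fun x hx => ht (Subsingleton.elim x t ▸ hx)

variable {m : ℕ} (M : Set (Euc s)) (t : ℕ → Euc s) (a : ℕ → ℝ)
  (V : ℕ → Matrix (Fin s) (Fin s) ℝ) (Vlow Vup : Matrix (Fin s) (Fin s) ℝ)

lemma scaleCondition_iff (C : Set (Euc s)) [NeZero s] (ha : Tendsto a atTop atTop)
    (hV : ∀ n, (V n).PosDef) (hlow : Vlow.PosDef) (hle : ∀ n, Vlow ≤ V n ∧ V n ≤ Vup) :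
    ScaleCondition C t (fun n => scaleMatrix (a n) (V n)) ↔
      Tendsto (fun n => ENNReal.ofReal (a n) * infEDist (t n) C) atTop (𝓝 ⊤) := by
  have ha0 := ha.eventually_gt_atTop 0
  refine tendsto_ofReal_div_nhds_zero_iff (c₁ := √‖Vlow‖) (c₂ := √‖Vup‖)
    (Real.sqrt_pos.2 (norm_pos_iff.2 hlow.isUnit.ne_zero)) ha0 ?_ ?_
  all_goals
    filter_upwards [ha0] with n hn
    have hsq := Matrix.norm_sqrt_sq (hV n).posSemidef.nonneg
    rw [norm_scaleMatrix hn]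
    gcongr
  · refine Real.sqrt_le_iff.2 ⟨norm_nonneg _, ?_⟩
    rw [hsq]
    exact Matrix.norm_le_norm_of_nonneg_of_le hlow.posSemidef.nonneg (hle n).1
  · refine Real.le_sqrt_of_sq_le ?_
    rw [hsq]
    exact Matrix.norm_le_norm_of_nonneg_of_le (hV n).posSemidef.nonneg (hle n).2

lemma stabilizedScaleCondition_iff (C : Set (Euc s)) (μ : ℕ → Euc s) [NeZero s]
    (ha : Tendsto a atTop atTop)
    (hV : ∀ n, (V n).PosDef) (hlow : Vlow.PosDef) (hle : ∀ n, Vlow ≤ V n ∧ V n ≤ Vup) :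
    StabilizedScaleCondition C t (fun n => scaleMatrix (a n) (V n))
        (fun n => gammaMatrix M (μ n) (a n) (V n)) ↔
      Tendsto (fun n => ENNReal.ofReal (a n) * infEDist (t n) C ^ 2) atTop (𝓝 ⊤) := by
  have ha0 := ha.eventually_gt_atTop 0
  obtain ⟨c, hc, hcl⟩ := hlow.exists_pos_smul_one_le
  have hVlow : 0 < ‖Vlow‖ := norm_pos_iff.2 hlow.isUnit.ne_zero
  have hup n : ‖V n‖ ≤ ‖Vup‖ :=
    Matrix.norm_le_norm_of_nonneg_of_le (hV n).posSemidef.nonneg (hle n).2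
  -- The constant c₁ comes from 1 ≤ ‖S^{-1/2}‖‖S^{1/2}‖ and ‖S‖ ≤ 2 + ‖Vup‖; c₂ comes from S ≥
  -- min(1, c)·1.
  refine tendsto_ofReal_div_nhds_zero_iff (c₁ := (√(2 + ‖Vup‖))⁻¹ * ‖Vlow‖)
    (c₂ := √(min 1 c)⁻¹ * ‖Vup‖) (by positivity) ha0 ?_ ?_
  all_goals
    filter_upwards [ha0] with n hn
    rw [norm_gammaMatrix_mul_norm_scaleMatrix_sq M _ hn (hV n).posSemidef.nonneg]
    gcongr
  · have hS := posDef_stabilizedMatrix M (μ n) (hV n)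
    rw [← one_div, div_le_iff₀ (by positivity)]
    refine hS.one_le_norm_sqrt_inv_mul.trans ?_
    gcongr
    refine Real.le_sqrt_of_sq_le ?_
    rw [Matrix.norm_sqrt_sq hS.posSemidef.nonneg]
    exact (norm_stabilizedMatrix_le M (μ n) (V n)).trans (by gcongr; exact hup n)
  · exact Matrix.norm_le_norm_of_nonneg_of_le hlow.posSemidef.nonneg (hle n).1
  · exact Real.le_sqrt_of_sq_le (Matrix.norm_sqrt_inv_sq_le (lt_min one_pos hc)
      (min_smul_one_le_stabilizedMatrix M (μ n) (hcl.trans (hle n).1)))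
  · exact hup n

lemma tendsto_ofReal_mul_top (ha : Tendsto a atTop atTop) :
    Tendsto (fun n => ENNReal.ofReal (a n) * ⊤) atTop (𝓝 ⊤) := by
  refine tendsto_const_nhds.congr' ?_
  filter_upwards [ha.eventually_gt_atTop 0] with n hn
  rw [ENNReal.mul_top (by simpa using hn)]

/-- The comparison for a sequence of matrices between two fixed positive definite ones. -/
lemma scaleConditions_of_between (ht : ∀ n, t n ∉ cutlocus m M) (ha : Tendsto a atTop atTop)
    (hV : ∀ n, (V n).PosDef) (hlow : Vlow.PosDef) (hle : ∀ n, Vlow ≤ V n ∧ V n ≤ Vup) :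
    (ScaleCondition (cutlocus m M) t (fun n => scaleMatrix (a n) (V n)) ↔
      Tendsto (fun n => ENNReal.ofReal (a n) * infEDist (t n) (cutlocus m M)) atTop (𝓝 ⊤)) ∧
    (∀ n, (stabilizedMatrix M (nearestPoint M (t n)) (V n)).PosDef ∧
      (a n ≠ 0 → IsNormalizing M (nearestPoint M (t n)) (scaleMatrix (a n) (V n))
        (gammaMatrix M (nearestPoint M (t n)) (a n) (V n)))) ∧
    (StabilizedScaleCondition (cutlocus m M) t (fun n => scaleMatrix (a n) (V n))
        (fun n => gammaMatrix M (nearestPoint M (t n)) (a n) (V n)) ↔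
      Tendsto (fun n => ENNReal.ofReal (a n) * infEDist (t n) (cutlocus m M) ^ 2)
        atTop (𝓝 ⊤)) := by
  refine ⟨?_, fun n => ⟨posDef_stabilizedMatrix M _ (hV n),
    isNormalizing_gammaMatrix M _ (hV n)⟩, ?_⟩
  · rcases Nat.eq_zero_or_pos s with rfl | hs
    · simp [ScaleCondition, cutlocus_eq_empty_of_dim_zero (ht 0), tendsto_ofReal_mul_top a ha]
    · have : NeZero s := ⟨hs.ne'⟩
      exact scaleCondition_iff t a V Vlow Vup _ ha hV hlow hle
  · rcases Nat.eq_zero_or_pos s with rfl | hs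
    · simp [StabilizedScaleCondition, cutlocus_eq_empty_of_dim_zero (ht 0),
        tendsto_ofReal_mul_top a ha]
    · have : NeZero s := ⟨hs.ne'⟩
      exact stabilizedScaleCondition_iff M t a V Vlow Vup _ _ ha hV hlow hle

end MeanLocation

open MeanLocation in
theorem corollary2p1 {s m : ℕ} (M : Set (Euc s)) (hMc : IsCompact M) (hM : IsSubmanifold m M)
    (t : ℕ → Euc s) (ht : ∀ n, t n ∉ cutlocus m M)
    (a : ℕ → ℝ) (ha : Tendsto a atTop atTop) :
    -- a fixed positive definite matrix
    (∀ V : Matrix (Fin s) (Fin s) ℝ, V.PosDef →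
      (ScaleCondition (cutlocus m M) t (fun n => scaleMatrix (a n) V) ↔
        Tendsto (fun n => ENNReal.ofReal (a n) * infEDist (t n) (cutlocus m M)) atTop (𝓝 ⊤)) ∧
      (∀ n, (stabilizedMatrix M (nearestPoint M (t n)) V).PosDef ∧
        (a n ≠ 0 → IsNormalizing M (nearestPoint M (t n)) (scaleMatrix (a n) V)
          (gammaMatrix M (nearestPoint M (t n)) (a n) V))) ∧
      (StabilizedScaleCondition (cutlocus m M) t (fun n => scaleMatrix (a n) V)
          (fun n => gammaMatrix M (nearestPoint M (t n)) (a n) V) ↔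
        Tendsto (fun n => ENNReal.ofReal (a n) * infEDist (t n) (cutlocus m M) ^ 2)
          atTop (𝓝 ⊤))) ∧
    -- a sequence of positive definite matrices between two fixed ones, in the Loewner order
    (∀ (V : ℕ → Matrix (Fin s) (Fin s) ℝ) (Vlow Vup : Matrix (Fin s) (Fin s) ℝ),
      (∀ n, (V n).PosDef) → Vlow.PosDef → Vup.PosDef → (∀ n, Vlow ≤ V n ∧ V n ≤ Vup) →
      (ScaleCondition (cutlocus m M) t (fun n => scaleMatrix (a n) (V n)) ↔
        Tendsto (fun n => ENNReal.ofReal (a n) * infEDist (t n) (cutlocus m M)) atTop (𝓝 ⊤)) ∧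
      (∀ n, (stabilizedMatrix M (nearestPoint M (t n)) (V n)).PosDef ∧
        (a n ≠ 0 → IsNormalizing M (nearestPoint M (t n)) (scaleMatrix (a n) (V n))
          (gammaMatrix M (nearestPoint M (t n)) (a n) (V n)))) ∧
      (StabilizedScaleCondition (cutlocus m M) t (fun n => scaleMatrix (a n) (V n))
          (fun n => gammaMatrix M (nearestPoint M (t n)) (a n) (V n)) ↔
        Tendsto (fun n => ENNReal.ofReal (a n) * infEDist (t n) (cutlocus m M) ^ 2)
          atTop (𝓝 ⊤))) := by
  -- A fixed V is a constant sequence lying between V and V.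
  exact ⟨fun V hV => scaleConditions_of_between M t a (fun _ => V) V V ht ha (fun _ => hV) hV
      fun _ => ⟨le_rfl, le_rfl⟩,
    fun V Vlow Vup hV hlow _ hle => scaleConditions_of_between M t a V Vlow Vup ht ha hV hlow hle⟩
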